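/- Let $n\ge 1$ be an integer, $[n]=\{1,\dots,n\}$, and $\Omega=2^{[n]}$ the set of all subsets of $[n]$. For $i=1,2$ let $\boldsymbol p_i=(p_i^{(1)},\dots,p_i^{(n)})$ be a vector of real numbers with $0<p_i^{(\ell)}<1$ for all $\ell\in[n]$, and let $\mu_i$ be the product measure \[ \mu_i(U)=\sum_{x\in U}\ \prod_{\ell\in x}p_i^{(\ell)}\prod_{k\in[n]\setminus x}\bigl(1-p_i^{(k)}\bigr)\qquad(U\subset\Omega). \] Put $p_i:=p_i^{(1)}$ and assume that $p_i=\max\{p_i^{(\ell)}:\ell\in[n]\}$ for $i=1,2$, and that $p_1^{(\ell)},p_2^{(\ell)}\le 1/2$ for all $\ell\ge 2$. Let $U_1,U_2\subset\Omega$ be cross-intersecting, that is, $x\cap y\ne\emptyset$ for all $x\in U_1$ and $y\in U_2$. Then \[ \mu_1(U_1)\,\mu_2(U_2)\le p_1p_2 . \] Moreover, let $w=\{\ell\in[n]:(p_1^{(\ell)},p_2^{(\ell)})=(p_1,p_2)\}$. Unless $p_1=p_2=1/2$ and $|w|\ge 3$, equality holds if and only if there is an $\ell\in w$ such that $U_1=U_2=\{x\in\Omega:\ell\in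 x\}$. -/

import Mathlib

namespace CrossIntersecting

/-- A probability vector: every entry lies strictly between `0` and `1`. -/
def IsProbabilityVector {n : ℕ} (p : Fin n → ℝ) : Prop :=
  ∀ l, 0 < p l ∧ p l < 1

/-- The product measure with respect to `p` of a family `U` of subsets of an `n`-element set:
`∑_{x ∈ U} ∏_{l ∈ x} p l * ∏_{k ∉ x} (1 - p k)`. -/
def productMeasure {n : ℕ} (p : Fin n → ℝ) (U : Finset (Finset (Fin n))) : ℝ :=
  ∑ x ∈ U, (∏ l ∈ x, p l) * ∏ k ∈ xᶜ, (1 - p k)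

/-- Every member of `U₁` meets every member of `U₂`. -/
def AreCrossIntersecting {n : ℕ} (U₁ U₂ : Finset (Finset (Fin n))) : Prop :=
  ∀ x ∈ U₁, ∀ y ∈ U₂, (x ∩ y).Nonempty

/-- The star at `l`: all subsets containing `l`. -/
def star {n : ℕ} (l : Fin n) : Finset (Finset (Fin n)) :=
  Finset.univ.filter fun x => l ∈ x

/-- The coordinates at which the pair of probabilities equals that of the coordinate `i`. -/
noncomputable def sameCoordinates {n : ℕ} (p₁ p₂ : Fin n → ℝ) (i : Fin n) : Finset (Fin n) :=
  Finset.univ.filter fun l => (p₁ l, p₂ l) = (p₁ i, p₂ i)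

end CrossIntersecting

namespace CrossIntersecting

open Finset

variable {n : ℕ}

/-! The argument is spectral. Expand the two indicators in the characters of their own product
measures, with coefficients A_S and B_S. Parseval gives the diagonal sums. A kernel whose factor at
a coordinate vanishes when both sets contain it gives a bilinear relation, with multiplier
`couplingWeight`, satisfied by every cross-intersecting pair.

Suppose first that the maxima t ≤ s are at most 1/2, and write a, b for the two measures. A
combination of these identities (`sum_fourierForm`) writes b s (st - ab) as b² t (a - s)², plus b²
(s - t) E with E the coupling energy of the first family, plus a binary quadratic form in (A_S, B_S)
for each nonempty S. The energy is nonnegative because the kernel is pointwise nonnegative for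
probabilities at most 1/2, and `discriminant` makes each form positive semidefinite. In case of
equality every summand vanishes. This kills A_S for |S| ≥ 2, apart from degenerate cases at s = 1/2
that need extra relations, and a 0/1 function of degree one vanishing at ∅ is the indicator of a
star (`exists_eq_star`).

A maximum above 1/2 is treated by interpolation: the measure is affine in one probability, so it
suffices to know the bound at 1/2 and at 1. At the endpoint 1 it follows from the ratio bound
`productMeasure_mul_le_ratio`, and there equality already forces the star at that coordinate. -/

/-! ### Product measures. -/

/-- The mass of a single set under the product measure. -/
def weight (p : Fin n → ℝ) (x : Finset (Fin n)) : ℝ :=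
  (∏ l ∈ x, p l) * ∏ k ∈ xᶜ, (1 - p k)

theorem productMeasure_eq_sum_weight (p : Fin n → ℝ) (U : Finset (Finset (Fin n))) :
    productMeasure p U = ∑ x ∈ U, weight p x := rfl

theorem weight_eq_prod (p : Fin n → ℝ) (x : Finset (Fin n)) :
    weight p x = ∏ l, if l ∈ x then p l else 1 - p l := by
  rw [weight, ← prod_mul_prod_compl x]
  congr 1
  · exact prod_congr rfl fun l hl => by simp [hl]
  · exact prod_congr rfl fun l hl => by simp [mem_compl.1 hl]

theorem weight_pos {p : Fin n → ℝ} (hp : IsProbabilityVector p) (x : Finset (Fin n)) :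
    0 < weight p x :=
  mul_pos (prod_pos fun l _ => (hp l).1) (prod_pos fun l _ => sub_pos.2 (hp l).2)

theorem weight_nonneg {p : Fin n → ℝ} (hp : ∀ l, 0 ≤ p l ∧ p l ≤ 1) (x : Finset (Fin n)) :
    0 ≤ weight p x :=
  mul_nonneg (prod_nonneg fun l _ => (hp l).1) (prod_nonneg fun l _ => sub_nonneg.2 (hp l).2)

theorem productMeasure_nonneg {p : Fin n → ℝ} (hp : ∀ l, 0 ≤ p l ∧ p l ≤ 1)
    (U : Finset (Finset (Fin n))) : 0 ≤ productMeasure p U :=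
  sum_nonneg fun x _ => weight_nonneg hp x

theorem productMeasure_univ (p : Fin n → ℝ) : productMeasure p univ = 1 := by
  have h := prod_add p (fun l => 1 - p l) (univ : Finset (Fin n))
  simp only [add_sub_cancel, prod_const_one, powerset_univ] at h
  rw [h, productMeasure]
  exact sum_congr rfl fun x _ => by rw [compl_eq_univ_sdiff]

theorem productMeasure_mono {p : Fin n → ℝ} (hp : ∀ l, 0 ≤ p l ∧ p l ≤ 1)
    {U V : Finset (Finset (Fin n))} (h : U ⊆ V) : productMeasure p U ≤ productMeasure p V :=
  sum_le_sum_of_subset_of_nonneg h fun x _ _ => weight_nonneg hp x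

theorem productMeasure_le_one {p : Fin n → ℝ} (hp : ∀ l, 0 ≤ p l ∧ p l ≤ 1)
    (U : Finset (Finset (Fin n))) : productMeasure p U ≤ 1 :=
  (productMeasure_mono hp (subset_univ U)).trans_eq (productMeasure_univ p)

theorem IsProbabilityVector.mem_Icc {p : Fin n → ℝ} (hp : IsProbabilityVector p) (l : Fin n) :
    0 ≤ p l ∧ p l ≤ 1 :=
  ⟨(hp l).1.le, (hp l).2.le⟩

theorem eq_of_subset_of_productMeasure_le {p : Fin n → ℝ} (hp : IsProbabilityVector p)
    {U V : Finset (Finset (Fin n))} (h : U ⊆ V) (hm : productMeasure p V ≤ productMeasure p U) :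
    U = V := by
  refine h.antisymm fun x hx => ?_
  by_contra hxU
  exact absurd hm (not_le.2 (sum_lt_sum_of_subset h hx hxU (weight_pos hp x)
    fun y _ _ => (weight_pos hp y).le))

/-! ### Fourier expansion and Parseval. -/

/-- The unnormalised character of the product measure attached to the set `S`. -/
def character (p : Fin n → ℝ) (S x : Finset (Fin n)) : ℝ :=
  ∏ l ∈ S, (p l - if l ∈ x then 1 else 0)

/-- The Fourier coefficient at `S` of the indicator function of `U`. -/
def coeff (p : Fin n → ℝ) (U : Finset (Finset (Fin n))) (S : Finset (Fin n)) : ℝ :=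
  ∑ x ∈ U, weight p x * character p S x

theorem coeff_empty (p : Fin n → ℝ) (U : Finset (Finset (Fin n))) :
    coeff p U ∅ = productMeasure p U := by
  simp [coeff, character, productMeasure_eq_sum_weight]

/-- Expanding the product over coordinates turns a multiplicative Fourier multiplier into a product
kernel. Parseval, inversion and the coupling relation all come from choices of `c`. -/
theorem sum_prod_mul_coeff_mul_coeff (c p q : Fin n → ℝ) (U V : Finset (Finset (Fin n))) :
    ∑ S, (∏ l ∈ S, c l) * (coeff p U S * coeff q V S) =
      ∑ x ∈ U, ∑ y ∈ V, weight p x * weight q y *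
        ∏ l, (1 + c l * ((p l - if l ∈ x then 1 else 0) * (q l - if l ∈ y then 1 else 0))) := by
  simp only [coeff, sum_mul_sum]
  simp only [mul_sum]
  rw [sum_comm]
  refine sum_congr rfl fun x _ => ?_
  rw [sum_comm]
  refine sum_congr rfl fun y _ => ?_
  rw [prod_one_add, powerset_univ, mul_sum]
  refine sum_congr rfl fun S _ => ?_
  rw [character, character, prod_mul_distrib, prod_mul_distrib]
  ring

/-- The Parseval weight of a character. -/
noncomputable def parsevalWeight (p : Fin n → ℝ) (S : Finset (Fin n)) : ℝ :=
  ∏ l ∈ S, (p l * (1 - p l))⁻¹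

theorem parsevalWeight_pos {p : Fin n → ℝ} (hp : IsProbabilityVector p) (S : Finset (Fin n)) :
    0 < parsevalWeight p S :=
  prod_pos fun l _ => inv_pos.2 (mul_pos (hp l).1 (sub_pos.2 (hp l).2))

/-- This multiplier makes the kernel diagonal: a coordinate where `x` and `y` disagree contributes
the factor 1 - 1 = 0. -/
theorem sum_parsevalWeight_mul_coeff_mul_coeff {p : Fin n → ℝ} (hp : IsProbabilityVector p)
    (U V : Finset (Finset (Fin n))) :
    ∑ S, parsevalWeight p S * (coeff p U S * coeff p V S) = productMeasure p (U ∩ V) := by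
  have key : ∀ x y : Finset (Fin n), weight p x * weight p y *
      ∏ l, (1 + (p l * (1 - p l))⁻¹ *
        ((p l - if l ∈ x then 1 else 0) * (p l - if l ∈ y then 1 else 0))) =
      if x = y then weight p x else 0 := by
    intro x y
    split_ifs with h
    · subst h
      simp only [weight_eq_prod, ← prod_mul_distrib]
      refine prod_congr rfl fun l _ => ?_
      have h1 := (hp l).1.ne'
      have h2 := (sub_pos.2 (hp l).2).ne'
      split_ifs <;> field_simp <;> ring
    · have : ∃ l, ¬ (l ∈ x ↔ l ∈ y) := by
        by_contra! hc
        exact h (Finset.ext hc)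
      obtain ⟨l, hl⟩ := this
      rw [prod_eq_zero (mem_univ l), mul_zero]
      have h1 := (hp l).1.ne'
      have h2 := (sub_pos.2 (hp l).2).ne'
      by_cases hx : l ∈ x <;> by_cases hy : l ∈ y <;> simp [hx, hy] at hl ⊢ <;> field_simp <;> ring
  simp only [parsevalWeight]
  rw [sum_prod_mul_coeff_mul_coeff]
  simp only [key, sum_ite_eq]
  rw [productMeasure_eq_sum_weight, ← sum_filter, filter_mem_eq_inter]

theorem sum_parsevalWeight_mul_coeff_sq {p : Fin n → ℝ} (hp : IsProbabilityVector p)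
    (U : Finset (Finset (Fin n))) :
    ∑ S, parsevalWeight p S * coeff p U S ^ 2 = productMeasure p U := by
  simpa [sq] using sum_parsevalWeight_mul_coeff_mul_coeff hp U U

theorem sum_parsevalWeight_mul_coeff_mul_character {p : Fin n → ℝ} (hp : IsProbabilityVector p)
    (U : Finset (Finset (Fin n))) (x : Finset (Fin n)) :
    ∑ S, parsevalWeight p S * (coeff p U S * character p S x) = if x ∈ U then 1 else 0 := by
  have h := sum_parsevalWeight_mul_coeff_mul_coeff hp U {x}
  have hx := (weight_pos hp x).ne'
  have e : ∀ S, coeff p {x} S = weight p x * character p S x := fun S => by simp [coeff]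
  apply mul_left_cancel₀ hx
  rw [mul_sum]
  calc _ = ∑ S, parsevalWeight p S * (coeff p U S * coeff p {x} S) :=
        sum_congr rfl fun S _ => by rw [e]; ring
    _ = _ := by
        rw [h]
        split_ifs with hm
        · simp [inter_singleton_of_mem hm, productMeasure_eq_sum_weight]
        · simp [inter_singleton_of_notMem hm, productMeasure_eq_sum_weight]

/-! ### The disjointness coupling. -/

/-- The multiplier of the coupling of two product measures that is concentrated on disjoint
pairs. -/
noncomputable def couplingWeight (p q : Fin n → ℝ) (S : Finset (Fin n)) : ℝ :=
  ∏ l ∈ S, -((1 - p l) * (1 - q l))⁻¹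

/-- At a common element of `x` and `y` the kernel factor is 1 - 1 = 0, so no cross-intersecting pair
contributes. -/
theorem sum_couplingWeight_eq_zero {p q : Fin n → ℝ} (hp : IsProbabilityVector p)
    (hq : IsProbabilityVector q) {U V : Finset (Finset (Fin n))} (hU : AreCrossIntersecting U V) :
    ∑ S, couplingWeight p q S * (coeff p U S * coeff q V S) = 0 := by
  simp only [couplingWeight]
  rw [sum_prod_mul_coeff_mul_coeff]
  refine sum_eq_zero fun x hx => sum_eq_zero fun y hy => ?_
  obtain ⟨l, hl⟩ := hU x hx y hy
  rw [mem_inter] at hl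
  rw [prod_eq_zero (mem_univ l), mul_zero]
  have h1 := (sub_pos.2 (hp l).2).ne'
  have h2 := (sub_pos.2 (hq l).2).ne'
  simp only [hl.1, hl.2, if_true]
  field_simp
  ring

/-- The kernel is pointwise nonnegative. The only factor that needs p ≤ 1/2 is the one at a
coordinate missing from both sets, (1 - 2p)/(1 - p)². -/
theorem sum_couplingWeight_nonneg {p : Fin n → ℝ} (hp : IsProbabilityVector p)
    (hhalf : ∀ l, p l ≤ 1 / 2) (U : Finset (Finset (Fin n))) :
    0 ≤ ∑ S, couplingWeight p p S * coeff p U S ^ 2 := by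
  simp only [couplingWeight, sq (coeff p U _)]
  rw [sum_prod_mul_coeff_mul_coeff]
  refine sum_nonneg fun x _ => sum_nonneg fun y _ => mul_nonneg
    (mul_pos (weight_pos hp x) (weight_pos hp y)).le (prod_nonneg fun l _ => ?_)
  have h1 := (hp l).1
  have h2 := sub_pos.2 (hp l).2
  have h3 := hhalf l
  have e : 1 + -((1 - p l) * (1 - p l))⁻¹ *
      ((p l - if l ∈ x then 1 else 0) * (p l - if l ∈ y then 1 else 0)) =
      ((1 - p l) ^ 2 - (p l - if l ∈ x then 1 else 0) * (p l - if l ∈ y then 1 else 0)) /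
        (1 - p l) ^ 2 := by
    field_simp
    ring
  rw [e]
  apply div_nonneg _ (sq_nonneg _)
  split_ifs <;> nlinarith

/-! ### Odds products and the discriminant inequality. -/

/-- The product of the odds of the coordinates in `S`. -/
noncomputable def oddsProd (p : Fin n → ℝ) (S : Finset (Fin n)) : ℝ :=
  ∏ l ∈ S, p l / (1 - p l)

theorem odds_pos {p : Fin n → ℝ} (hp : IsProbabilityVector p) (l : Fin n) :
    0 < p l / (1 - p l) :=
  div_pos (hp l).1 (sub_pos.2 (hp l).2)

theorem oddsProd_pos {p : Fin n → ℝ} (hp : IsProbabilityVector p) (S : Finset (Fin n)) :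
    0 < oddsProd p S :=
  prod_pos fun l _ => odds_pos hp l

theorem couplingWeight_sq {p q : Fin n → ℝ} (hp : IsProbabilityVector p)
    (hq : IsProbabilityVector q) (S : Finset (Fin n)) :
    couplingWeight p q S ^ 2 =
      oddsProd p S * oddsProd q S * (parsevalWeight p S * parsevalWeight q S) := by
  simp only [couplingWeight, oddsProd, parsevalWeight, ← prod_mul_distrib, ← prod_pow]
  refine prod_congr rfl fun l _ => ?_
  have h1 := (hp l).1.ne'
  have h2 := (sub_pos.2 (hp l).2).ne'
  have h3 := (hq l).1.ne'
  have h4 := (sub_pos.2 (hq l).2).ne'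
  field_simp

theorem couplingWeight_self {p : Fin n → ℝ} (hp : IsProbabilityVector p) (S : Finset (Fin n)) :
    couplingWeight p p S = (-1) ^ #S * oddsProd p S * parsevalWeight p S := by
  simp only [couplingWeight, oddsProd, parsevalWeight]
  rw [← prod_const, ← prod_mul_distrib, ← prod_mul_distrib]
  refine prod_congr rfl fun l _ => ?_
  have h1 := (hp l).1.ne'
  have h2 := (sub_pos.2 (hp l).2).ne'
  field_simp

theorem odds_le_odds {s t : ℝ} (ht : t < 1) (hst : s ≤ t) : s / (1 - s) ≤ t / (1 - t) := by
  rw [div_le_div_iff₀ (by linarith) (by linarith)]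
  nlinarith

theorem odds_lt_odds {s t : ℝ} (ht : t < 1) (hst : s < t) : s / (1 - s) < t / (1 - t) := by
  rw [div_lt_div_iff₀ (by linarith) (by linarith)]
  nlinarith

theorem odds_le_one {t : ℝ} (ht : t ≤ 1 / 2) : t / (1 - t) ≤ 1 := by
  rw [div_le_one (by linarith)]
  linarith

theorem odds_lt_one {t : ℝ} (ht : t < 1 / 2) : t / (1 - t) < 1 := by
  rw [div_lt_one (by linarith)]
  linarith

theorem oddsProd_le_pow {p : Fin n → ℝ} (hp : IsProbabilityVector p) {t : ℝ} (ht : t ≤ 1 / 2)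
    (hle : ∀ l, p l ≤ t) {S : Finset (Fin n)} {k : ℕ} (hk : k ≤ #S) :
    oddsProd p S ≤ (t / (1 - t)) ^ k := by
  calc oddsProd p S ≤ (t / (1 - t)) ^ #S := by
        rw [← prod_const]
        exact prod_le_prod (fun l _ => (odds_pos hp l).le)
          fun l _ => odds_le_odds (by linarith) (hle l)
    _ ≤ _ := by
        rcases S.eq_empty_or_nonempty with rfl | ⟨l, -⟩
        · simp at hk; simp [hk]
        · exact pow_le_pow_of_le_one (div_nonneg ((hp l).1.le.trans (hle l)) (by linarith))
            (odds_le_one ht) hk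

theorem oddsProd_lt_pow {p : Fin n → ℝ} (hp : IsProbabilityVector p) {t : ℝ} (ht : t ≤ 1 / 2)
    (hle : ∀ l, p l ≤ t) {S : Finset (Fin n)} {k : ℕ} (hk : k ≤ #S) (hS : S.Nonempty)
    (h : (∃ l ∈ S, p l ≠ t) ∨ (t ≠ 1 / 2 ∧ k ≠ #S)) :
    oddsProd p S < (t / (1 - t)) ^ k := by
  obtain ⟨m, hm⟩ := hS
  have hpos : 0 < t / (1 - t) := div_pos ((hp m).1.trans_le (hle m)) (by linarith)
  have h1 : oddsProd p S ≤ (t / (1 - t)) ^ #S := oddsProd_le_pow hp ht hle le_rfl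
  have h2 : (t / (1 - t)) ^ #S ≤ (t / (1 - t)) ^ k :=
    pow_le_pow_of_le_one hpos.le (odds_le_one ht) hk
  rcases h with ⟨l, hl, hne⟩ | ⟨hne, hkne⟩
  · refine lt_of_lt_of_le ?_ h2
    rw [← prod_const]
    exact prod_lt_prod (fun l _ => odds_pos hp l)
      (fun l _ => odds_le_odds (by linarith) (hle l))
      ⟨l, hl, odds_lt_odds (by linarith) (lt_of_le_of_ne (hle l) hne)⟩
  · exact h1.trans_lt (pow_lt_pow_right_of_lt_one₀ hpos
      (odds_lt_one (lt_of_le_of_ne ht hne)) (lt_of_le_of_ne hk hkne))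

theorem binary_form_nonneg {A B C : ℝ} (hB : 0 < B) (h : C ^ 2 ≤ A * B) (x y : ℝ) :
    0 ≤ A * x ^ 2 + B * y ^ 2 + 2 * C * (x * y) := by
  have : 0 ≤ B * (A * x ^ 2 + B * y ^ 2 + 2 * C * (x * y)) := by
    nlinarith [sq_nonneg (B * y + C * x), mul_nonneg (sub_nonneg.2 h) (sq_nonneg x)]
  exact nonneg_of_mul_nonneg_right this hB

theorem eq_zero_of_binary_form_eq_zero {A B C : ℝ} (h : C ^ 2 < A * B) {x y : ℝ}
    (h0 : A * x ^ 2 + B * y ^ 2 + 2 * C * (x * y) = 0) : x = 0 := by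
  have e : (B * y + C * x) ^ 2 + (A * B - C ^ 2) * x ^ 2 = 0 := by linear_combination B * h0
  have h1 : (A * B - C ^ 2) * x ^ 2 = 0 :=
    le_antisymm (by nlinarith [sq_nonneg (B * y + C * x)])
      (mul_nonneg (sub_pos.2 h).le (sq_nonneg x))
  simpa [(sub_pos.2 h).ne'] using h1

/-- The discriminant condition for the quadratic form at an odd set, with `X`, `Y` the products
of the odds and `s`, `t` the largest probabilities. -/
theorem odd_discriminant {s t X Y : ℝ} (ht : 0 < t) (hts : t ≤ s) (hs : s ≤ 1 / 2)
    (hX0 : 0 < X) (hX : X ≤ s / (1 - s)) (hY : Y ≤ t / (1 - t)) :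
    (1 - t) ^ 2 * (X * Y) ≤ t * (s + (s - t) * X) ∧
      ((1 - t) ^ 2 * (X * Y) = t * (s + (s - t) * X) →
        X = s / (1 - s) ∧ Y = t / (1 - t)) := by
  rw [le_div_iff₀ (by linarith)] at hX hY
  rw [eq_div_iff (by linarith), eq_div_iff (by linarith)]
  -- The slack splits into two nonnegative terms, one for each hypothesis on `X` and `Y`, so
  -- equality forces both hypotheses to be tight.
  have e : t * (s + (s - t) * X) - (1 - t) ^ 2 * (X * Y) =
      t * (s - X * (1 - s)) + (1 - t) * X * (t - Y * (1 - t)) := by ring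
  have h1 : 0 ≤ t * (s - X * (1 - s)) := mul_nonneg ht.le (sub_nonneg.2 hX)
  have h2 : 0 < (1 - t) * X := mul_pos (by linarith) hX0
  have h3 : 0 ≤ (1 - t) * X * (t - Y * (1 - t)) := mul_nonneg h2.le (sub_nonneg.2 hY)
  refine ⟨by linarith, fun h => ?_⟩
  have h4 : t * (s - X * (1 - s)) = 0 := by linarith
  have h5 : (1 - t) * X * (t - Y * (1 - t)) = 0 := by linarith
  rw [mul_eq_zero] at h4 h5
  constructor
  · linarith [h4.resolve_left ht.ne']
  · linarith [h5.resolve_left h2.ne']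

/-- For even sets the correction (s - t) X has the unfavourable sign. This is compensated by |S| ≥
2, which allows the squared odds as a bound for `Y`, while X ≤ 1 is enough for `X`. -/
theorem even_discriminant {s t X Y : ℝ} (ht : 0 < t) (hts : t ≤ s) (hs : s ≤ 1 / 2)
    (hX0 : 0 < X) (hX : X ≤ 1) (hY : Y ≤ (t / (1 - t)) ^ 2) :
    (1 - t) ^ 2 * (X * Y) ≤ t * (s - (s - t) * X) ∧
      ((1 - t) ^ 2 * (X * Y) = t * (s - (s - t) * X) → X = 1 ∧ Y = (t / (1 - t)) ^ 2) := by
  have hq : 0 < (1 - t) ^ 2 := pow_pos (by linarith) 2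
  rw [div_pow, le_div_iff₀ hq] at hY
  rw [div_pow, eq_div_iff hq.ne']
  have e : t * (s - (s - t) * X) - (1 - t) ^ 2 * (X * Y) =
      t * s * (1 - X) + X * (t ^ 2 - Y * (1 - t) ^ 2) := by ring
  have hts' : 0 < t * s := mul_pos ht (by linarith)
  have h1 : 0 ≤ t * s * (1 - X) := mul_nonneg hts'.le (sub_nonneg.2 hX)
  have h3 : 0 ≤ X * (t ^ 2 - Y * (1 - t) ^ 2) := mul_nonneg hX0.le (sub_nonneg.2 hY)
  refine ⟨by linarith, fun h => ?_⟩
  have h4 : t * s * (1 - X) = 0 := by linarith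
  have h5 : X * (t ^ 2 - Y * (1 - t) ^ 2) = 0 := by linarith
  rw [mul_eq_zero] at h4 h5
  constructor
  · linarith [h4.resolve_left hts'.ne']
  · linarith [h5.resolve_left hX0.ne']

/-- The discriminant condition at an arbitrary nonempty set, with its equality case. -/
theorem discriminant {p₁ p₂ : Fin n → ℝ} (hp₁ : IsProbabilityVector p₁)
    (hp₂ : IsProbabilityVector p₂) {s t : ℝ} (hts : t ≤ s) (hs : s ≤ 1 / 2)
    (hs' : ∀ l, p₁ l ≤ s) (ht' : ∀ l, p₂ l ≤ t) {S : Finset (Fin n)} (hS : S.Nonempty) :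
    (1 - t) ^ 2 * (oddsProd p₁ S * oddsProd p₂ S) ≤
        t * (s - (s - t) * ((-1) ^ #S * oddsProd p₁ S)) ∧
      ((1 - t) ^ 2 * (oddsProd p₁ S * oddsProd p₂ S) =
          t * (s - (s - t) * ((-1) ^ #S * oddsProd p₁ S)) →
        (∀ l ∈ S, p₁ l = s ∧ p₂ l = t) ∧
          (#S = 1 ∨ (#S = 2 ∧ s = 1 / 2) ∨ (s = 1 / 2 ∧ t = 1 / 2))) := by
  obtain ⟨m, hm⟩ := hS
  have hS : S.Nonempty := ⟨m, hm⟩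
  have hcard : 1 ≤ #S := hS.card_pos
  have ht : 0 < t := (hp₂ m).1.trans_le (ht' m)
  have hpos := oddsProd_pos hp₁ S
  have eq_of {p : Fin n → ℝ} (hp : IsProbabilityVector p) {u : ℝ} (hu : u ≤ 1 / 2)
      (hle : ∀ l, p l ≤ u) {k : ℕ} (hk : k ≤ #S) (h : oddsProd p S = (u / (1 - u)) ^ k) :
      (∀ l ∈ S, p l = u) ∧ (u = 1 / 2 ∨ k = #S) := by
    constructor
    · by_contra! hc
      exact (oddsProd_lt_pow hp hu hle hk hS (Or.inl hc)).ne h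
    · by_contra! hc
      exact (oddsProd_lt_pow hp hu hle hk hS (Or.inr hc)).ne h
  have ht2 : t ≤ 1 / 2 := hts.trans hs
  rcases Nat.even_or_odd (#S) with he | ho
  · have h2 : 2 ≤ #S := by
      obtain ⟨k, hk⟩ := he
      omega
    rw [he.neg_one_pow, one_mul]
    have hX : oddsProd p₁ S ≤ 1 := by
      simpa using oddsProd_le_pow hp₁ hs hs' (Nat.zero_le (#S))
    have hX2 := oddsProd_le_pow hp₁ hs hs' h2
    have hodds : 0 < s / (1 - s) := div_pos (by linarith) (by linarith)
    obtain ⟨hle, heq⟩ := even_discriminant ht hts hs hpos hX (oddsProd_le_pow hp₂ ht2 ht' h2)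
    refine ⟨hle, fun h => ?_⟩
    obtain ⟨hX1, hY1⟩ := heq h
    -- X = 1 is impossible when s < 1/2, since then X is at most the square of an odds ratio below
    -- 1.
    have hs1 : s = 1 / 2 := by
      by_contra hne
      have := pow_lt_one₀ hodds.le (odds_lt_one (lt_of_le_of_ne hs hne)) two_ne_zero
      linarith
    have hX3 := eq_of hp₁ hs hs' h2 (by rw [hX1, hs1]; norm_num)
    have hY3 := eq_of hp₂ ht2 ht' h2 hY1
    refine ⟨fun l hl => ⟨hX3.1 l hl, hY3.1 l hl⟩, Or.inr ?_⟩
    rcases hY3.2 with h | h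
    · exact Or.inr ⟨hs1, h⟩
    · exact Or.inl ⟨h.symm, hs1⟩
  · rw [ho.neg_one_pow, neg_one_mul, mul_neg, sub_neg_eq_add]
    have hX := oddsProd_le_pow hp₁ hs hs' hcard
    have hY := oddsProd_le_pow hp₂ ht2 ht' hcard
    obtain ⟨hle, heq⟩ := odd_discriminant ht hts hs hpos (by simpa using hX) (by simpa using hY)
    refine ⟨hle, fun h => ?_⟩
    obtain ⟨hX1, hY1⟩ := heq h
    have hX3 := eq_of hp₁ hs hs' hcard (by simpa using hX1)
    have hY3 := eq_of hp₂ ht2 ht' hcard (by simpa using hY1)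
    refine ⟨fun l hl => ⟨hX3.1 l hl, hY3.1 l hl⟩, ?_⟩
    rcases hX3.2 with h | h
    · rcases hY3.2 with h' | h'
      · exact Or.inr (Or.inr ⟨h, h'⟩)
      · exact Or.inl h'.symm
    · exact Or.inl h.symm

/-! ### The sum-of-forms identity and the bound for probabilities at most 1/2. -/

/-- The quadratic form at `S` in the Fourier coefficients of a cross-intersecting pair. -/
noncomputable def fourierForm (p₁ p₂ : Fin n → ℝ) (s t : ℝ) (U₁ U₂ : Finset (Finset (Fin n)))
    (S : Finset (Fin n)) : ℝ :=
  productMeasure p₂ U₂ ^ 2 * (s * parsevalWeight p₁ S - (s - t) * couplingWeight p₁ p₁ S) *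
      coeff p₁ U₁ S ^ 2 +
    s ^ 2 * t * parsevalWeight p₂ S * coeff p₂ U₂ S ^ 2 +
    2 * (productMeasure p₂ U₂ * s * (1 - t) * couplingWeight p₁ p₂ S) *
      (coeff p₁ U₁ S * coeff p₂ U₂ S)

/-- The multipliers are chosen so that the term at ∅ completes the square (a - s)². The coupling
energy is moved out of the forms because, for t < s, the form at a singleton attaining both maxima
would otherwise be indefinite; with the correction it is exactly degenerate. -/
theorem sum_fourierForm {p₁ p₂ : Fin n → ℝ} (hp₁ : IsProbabilityVector p₁)
    (hp₂ : IsProbabilityVector p₂) (s t : ℝ) {U₁ U₂ : Finset (Finset (Fin n))}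
    (hU : AreCrossIntersecting U₁ U₂) :
    productMeasure p₂ U₂ * s * (s * t - productMeasure p₁ U₁ * productMeasure p₂ U₂) =
      productMeasure p₂ U₂ ^ 2 * t * (productMeasure p₁ U₁ - s) ^ 2 +
      productMeasure p₂ U₂ ^ 2 * (s - t) * ∑ S, couplingWeight p₁ p₁ S * coeff p₁ U₁ S ^ 2 +
      ∑ S ∈ univ.erase ∅, fourierForm p₁ p₂ s t U₁ U₂ S := by
  have h0 : fourierForm p₁ p₂ s t U₁ U₂ ∅ +
      ∑ S ∈ univ.erase ∅, fourierForm p₁ p₂ s t U₁ U₂ S =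
      ∑ S, fourierForm p₁ p₂ s t U₁ U₂ S := add_sum_erase _ _ (mem_univ _)
  have h1 := sum_parsevalWeight_mul_coeff_sq hp₁ U₁
  have h2 := sum_parsevalWeight_mul_coeff_sq hp₂ U₂
  have h3 := sum_couplingWeight_eq_zero hp₁ hp₂ hU
  have h4 : ∑ S, fourierForm p₁ p₂ s t U₁ U₂ S =
      productMeasure p₂ U₂ ^ 2 * s * ∑ S, parsevalWeight p₁ S * coeff p₁ U₁ S ^ 2 -
      productMeasure p₂ U₂ ^ 2 * (s - t) * ∑ S, couplingWeight p₁ p₁ S * coeff p₁ U₁ S ^ 2 +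
      s ^ 2 * t * ∑ S, parsevalWeight p₂ S * coeff p₂ U₂ S ^ 2 +
      2 * (productMeasure p₂ U₂ * s * (1 - t)) *
        ∑ S, couplingWeight p₁ p₂ S * (coeff p₁ U₁ S * coeff p₂ U₂ S) := by
    simp only [mul_sum]
    rw [← sum_sub_distrib, ← sum_add_distrib, ← sum_add_distrib]
    exact sum_congr rfl fun S _ => by rw [fourierForm]; ring
  have h5 : fourierForm p₁ p₂ s t U₁ U₂ ∅ =
      productMeasure p₂ U₂ ^ 2 * t * productMeasure p₁ U₁ ^ 2 +
      s ^ 2 * t * productMeasure p₂ U₂ ^ 2 +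
      2 * (productMeasure p₂ U₂ * s * (1 - t)) *
        (productMeasure p₁ U₁ * productMeasure p₂ U₂) := by
    simp only [fourierForm, coeff_empty, parsevalWeight, couplingWeight, prod_empty]
    ring
  rw [h1, h2, h3] at h4
  linear_combination h5 - h0 - h4

theorem fourierForm_discriminant {p₁ p₂ : Fin n → ℝ} (hp₁ : IsProbabilityVector p₁)
    (hp₂ : IsProbabilityVector p₂) (s t b : ℝ) (S : Finset (Fin n)) :
    b ^ 2 * (s * parsevalWeight p₁ S - (s - t) * couplingWeight p₁ p₁ S) *
        (s ^ 2 * t * parsevalWeight p₂ S) - (b * s * (1 - t) * couplingWeight p₁ p₂ S) ^ 2 =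
      b ^ 2 * s ^ 2 * (parsevalWeight p₁ S * parsevalWeight p₂ S) *
        (t * (s - (s - t) * ((-1) ^ #S * oddsProd p₁ S)) -
          (1 - t) ^ 2 * (oddsProd p₁ S * oddsProd p₂ S)) := by
  rw [mul_pow _ (couplingWeight p₁ p₂ S), couplingWeight_sq hp₁ hp₂, couplingWeight_self hp₁]
  ring

theorem fourierForm_nonneg {p₁ p₂ : Fin n → ℝ} (hp₁ : IsProbabilityVector p₁)
    (hp₂ : IsProbabilityVector p₂) {s t : ℝ} (hts : t ≤ s) (hs : s ≤ 1 / 2)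
    (hs' : ∀ l, p₁ l ≤ s) (ht' : ∀ l, p₂ l ≤ t) (U₁ U₂ : Finset (Finset (Fin n)))
    {S : Finset (Fin n)} (hS : S.Nonempty) :
    0 ≤ fourierForm p₁ p₂ s t U₁ U₂ S := by
  obtain ⟨m, -⟩ := id hS
  have ht : 0 < t := (hp₂ m).1.trans_le (ht' m)
  have h1 := parsevalWeight_pos hp₁ S
  have h2 := parsevalWeight_pos hp₂ S
  have hs0 : 0 < s := ht.trans_le hts
  refine binary_form_nonneg (by positivity) (sub_nonneg.1 ?_) _ _
  rw [fourierForm_discriminant hp₁ hp₂]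
  exact mul_nonneg (by positivity)
    (sub_nonneg.2 (discriminant hp₁ hp₂ hts hs hs' ht' hS).1)

theorem coeff_eq_zero_of_fourierForm_eq_zero {p₁ p₂ : Fin n → ℝ} (hp₁ : IsProbabilityVector p₁)
    (hp₂ : IsProbabilityVector p₂) {s t : ℝ} (hts : t ≤ s) (hs : s ≤ 1 / 2)
    (hs' : ∀ l, p₁ l ≤ s) (ht' : ∀ l, p₂ l ≤ t) {U₁ U₂ : Finset (Finset (Fin n))}
    (hb : 0 < productMeasure p₂ U₂) {S : Finset (Fin n)} (hS : S.Nonempty)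
    (h0 : fourierForm p₁ p₂ s t U₁ U₂ S = 0)
    (hne : ¬ ((∀ l ∈ S, p₁ l = s ∧ p₂ l = t) ∧
      (#S = 1 ∨ (#S = 2 ∧ s = 1 / 2) ∨ (s = 1 / 2 ∧ t = 1 / 2)))) :
    coeff p₁ U₁ S = 0 := by
  obtain ⟨m, -⟩ := id hS
  have ht : 0 < t := (hp₂ m).1.trans_le (ht' m)
  have h1 := parsevalWeight_pos hp₁ S
  have h2 := parsevalWeight_pos hp₂ S
  have hs0 : 0 < s := ht.trans_le hts
  refine eq_zero_of_binary_form_eq_zero (sub_pos.1 ?_) h0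
  rw [fourierForm_discriminant hp₁ hp₂]
  obtain ⟨hle, heq⟩ := discriminant hp₁ hp₂ hts hs hs' ht' hS
  exact mul_pos (by positivity) (sub_pos.2 (lt_of_le_of_ne hle (mt heq hne)))

theorem productMeasure_mul_le_of_le_half {p₁ p₂ : Fin n → ℝ} (hp₁ : IsProbabilityVector p₁)
    (hp₂ : IsProbabilityVector p₂) {s t : ℝ} (ht : 0 < t) (hts : t ≤ s) (hs : s ≤ 1 / 2)
    (hs' : ∀ l, p₁ l ≤ s) (ht' : ∀ l, p₂ l ≤ t) {U₁ U₂ : Finset (Finset (Fin n))}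
    (hU : AreCrossIntersecting U₁ U₂) :
    productMeasure p₁ U₁ * productMeasure p₂ U₂ ≤ s * t := by
  have hs0 : 0 < s := ht.trans_le hts
  rcases (productMeasure_nonneg hp₂.mem_Icc U₂).eq_or_lt with hb | hb
  · rw [← hb, mul_zero]
    positivity
  have h := sum_fourierForm hp₁ hp₂ s t hU
  have h1 := sum_couplingWeight_nonneg hp₁ (fun l => (hs' l).trans hs) U₁
  have h2 : 0 ≤ ∑ S ∈ univ.erase ∅, fourierForm p₁ p₂ s t U₁ U₂ S :=
    sum_nonneg fun S hS => fourierForm_nonneg hp₁ hp₂ hts hs hs' ht' U₁ U₂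
      (nonempty_iff_ne_empty.2 (ne_of_mem_erase hS))
  have h3 : 0 ≤ s - t := sub_nonneg.2 hts
  exact sub_nonneg.1 (nonneg_of_mul_nonneg_right (h ▸ by positivity) (mul_pos hb hs0))

/-! ### Equality for probabilities at most 1/2. -/

theorem sum_eq_empty_add_sum_singleton {f : Finset (Fin n) → ℝ} (hf : ∀ S, 2 ≤ #S → f S = 0) :
    ∑ S, f S = f ∅ + ∑ l, f {l} := by
  rw [← add_sum_erase univ f (mem_univ ∅)]
  congr 1
  refine Eq.trans ?_ (sum_map univ ⟨singleton, singleton_injective⟩ f)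
  refine (sum_subset (fun S hS => ?_) fun S hS hS' => hf S ?_).symm
  · obtain ⟨l, -, rfl⟩ := mem_map.1 hS
    simp
  · have h0 : 0 < #S := card_pos.2 (nonempty_iff_ne_empty.2 (ne_of_mem_erase hS))
    have h1 : #S ≠ 1 := fun h => by
      obtain ⟨l, rfl⟩ := card_eq_one.1 h
      exact hS' (mem_map.2 ⟨l, mem_univ l, rfl⟩)
    omega

/-- A nonempty family avoiding the empty set whose indicator function has degree one is a star. -/
theorem exists_eq_star {p : Fin n → ℝ} (hp : IsProbabilityVector p)
    {U : Finset (Finset (Fin n))} (hne : U.Nonempty) (h0 : ∅ ∉ U)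
    (hdeg : ∀ S, 2 ≤ #S → coeff p U S = 0) : ∃ l, U = star l := by
  set γ : Fin n → ℝ := fun l => -(parsevalWeight p {l} * coeff p U {l}) with hγ
  have haff : ∀ x, (if x ∈ U then (1 : ℝ) else 0) =
      productMeasure p U + ∑ l, -γ l * (p l - if l ∈ x then 1 else 0) := by
    intro x
    rw [← sum_parsevalWeight_mul_coeff_mul_character hp U x,
      sum_eq_empty_add_sum_singleton fun S hS => by rw [hdeg S hS]; ring, coeff_empty]
    simp only [parsevalWeight, character, prod_empty, prod_singleton, hγ]
    ring_nf
  -- Subtracting the value at ∅, which is 0, makes the affine function linear. Singletons then give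
  -- γ values in {0, 1}, and a pair with both values 1 would give the indicator the value 2.
  have hlin : ∀ x, (if x ∈ U then (1 : ℝ) else 0) = ∑ l ∈ x, γ l := by
    intro x
    have e1 := haff x
    have e2 := haff ∅
    simp only [h0, if_false, notMem_empty, sub_zero] at e2
    have e3 : ∑ l ∈ x, γ l = ∑ l, γ l * if l ∈ x then 1 else 0 := by simp
    rw [e1, e3, ← sub_zero (productMeasure p U + _), e2, add_sub_add_left_eq_sub,
      ← sum_sub_distrib]
    exact sum_congr rfl fun l _ => by ring
  have h01 : ∀ l, γ l = 0 ∨ γ l = 1 := fun l => by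
    have := hlin {l}
    rw [sum_singleton] at this
    rw [← this]
    split_ifs <;> simp
  obtain ⟨z, hz⟩ := hne
  have hz' := hlin z
  rw [if_pos hz] at hz'
  obtain ⟨l, hl, hl0⟩ := exists_ne_zero_of_sum_ne_zero (hz' ▸ one_ne_zero)
  have hl1 : γ l = 1 := (h01 l).resolve_left hl0
  have hother : ∀ m, m ≠ l → γ m = 0 := fun m hm => by
    refine (h01 m).resolve_right fun h1 => ?_
    have := hlin {m, l}
    rw [sum_pair hm, h1, hl1] at this
    split_ifs at this <;> norm_num at this
  refine ⟨l, Finset.ext fun x => ?_⟩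
  have hx := hlin x
  have e : ∑ m ∈ x, γ m = if l ∈ x then 1 else 0 := by
    rw [← hl1, ← sum_ite_eq' x l γ]
    refine sum_congr rfl fun m _ => ?_
    split_ifs with h
    · rfl
    · exact hother m h
  rw [e] at hx
  simp only [star, mem_filter, mem_univ, true_and]
  split_ifs at hx <;> simp_all

/-- Adding Parseval to the vanishing energy gives a sum of nonnegative terms equal to 1/2. The term
at ∅ is 2 · (1/2)² and uses all of it, and at an even set the remaining multiplier is strictly
positive. -/
theorem coeff_eq_zero_of_coupling_eq_zero {p : Fin n → ℝ} (hp : IsProbabilityVector p)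
    (hhalf : ∀ l, p l ≤ 1 / 2) {U : Finset (Finset (Fin n))} (ha : productMeasure p U = 1 / 2)
    (hE : ∑ S, couplingWeight p p S * coeff p U S ^ 2 = 0) {S : Finset (Fin n)} (hS : #S = 2) :
    coeff p U S = 0 := by
  have hX : ∀ T, 0 < oddsProd p T ∧ oddsProd p T ≤ 1 := fun T =>
    ⟨oddsProd_pos hp T, by simpa using oddsProd_le_pow hp le_rfl hhalf (Nat.zero_le (#T))⟩
  have hnonneg : ∀ T, 0 ≤ (parsevalWeight p T + couplingWeight p p T) * coeff p U T ^ 2 := by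
    intro T
    refine mul_nonneg ?_ (sq_nonneg _)
    have hW := parsevalWeight_pos hp T
    rw [couplingWeight_self hp]
    rcases neg_one_pow_eq_or ℝ (#T) with h | h <;> rw [h] <;> nlinarith [hX T]
  have hsum : ∑ T, (parsevalWeight p T + couplingWeight p p T) * coeff p U T ^ 2 = 1 / 2 := by
    simp only [add_mul, sum_add_distrib]
    rw [hE, sum_parsevalWeight_mul_coeff_sq hp, ha, add_zero]
  rw [← add_sum_erase univ _ (mem_univ ∅), coeff_empty, ha] at hsum
  simp only [parsevalWeight, couplingWeight, prod_empty] at hsum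
  have h0 := (sum_eq_zero_iff_of_nonneg fun T _ => hnonneg T).1
    (show ∑ T ∈ univ.erase ∅, (parsevalWeight p T + couplingWeight p p T) * coeff p U T ^ 2 = 0 by
      simp only [parsevalWeight, couplingWeight]
      linarith) S (mem_erase.2 ⟨by rintro rfl; simp at hS, mem_univ _⟩)
  have hW := parsevalWeight_pos hp S
  rw [couplingWeight_self hp, hS] at h0
  have : parsevalWeight p S + (-1) ^ 2 * oddsProd p S * parsevalWeight p S ≠ 0 := by
    have := (hX S).1
    positivity
  exact pow_eq_zero_iff two_ne_zero |>.1 ((mul_eq_zero.1 h0).resolve_left this)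

/-- On coordinates of probability 1/2 the form degenerates to a perfect square, so its vanishing
fixes one coefficient as plus or minus the other. -/
theorem fourierForm_half {p₁ p₂ : Fin n → ℝ} (hp₁ : IsProbabilityVector p₁)
    {U₁ U₂ : Finset (Finset (Fin n))} (hb : productMeasure p₂ U₂ = 1 / 2) {S : Finset (Fin n)}
    (hS : ∀ l ∈ S, p₁ l = 1 / 2 ∧ p₂ l = 1 / 2) :
    fourierForm p₁ p₂ (1 / 2) (1 / 2) U₁ U₂ S =
      1 / 8 * parsevalWeight p₁ S * (coeff p₁ U₁ S + (-1) ^ #S * coeff p₂ U₂ S) ^ 2 := by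
  have h1 : parsevalWeight p₂ S = parsevalWeight p₁ S :=
    prod_congr rfl fun l hl => by rw [(hS l hl).1, (hS l hl).2]
  have h2 : couplingWeight p₁ p₂ S = couplingWeight p₁ p₁ S :=
    prod_congr rfl fun l hl => by rw [(hS l hl).1, (hS l hl).2]
  have h3 : oddsProd p₁ S = 1 := prod_eq_one fun l hl => by rw [(hS l hl).1]; norm_num
  rw [fourierForm, h1, h2, couplingWeight_self hp₁, h3, hb]
  rcases neg_one_pow_eq_or ℝ (#S) with h | h <;> rw [h] <;> ring

theorem exists_eq_star_of_le_half {p₁ p₂ : Fin n → ℝ} (hp₁ : IsProbabilityVector p₁)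
    (hp₂ : IsProbabilityVector p₂) {s t : ℝ} (ht : 0 < t) (hts : t ≤ s) (hs : s ≤ 1 / 2)
    (hs' : ∀ l, p₁ l ≤ s) (ht' : ∀ l, p₂ l ≤ t) {U₁ U₂ : Finset (Finset (Fin n))}
    (hU : AreCrossIntersecting U₁ U₂)
    (hw : ¬ (s = 1 / 2 ∧ t = 1 / 2 ∧
      3 ≤ #(univ.filter fun l => p₁ l = s ∧ p₂ l = t)))
    (heq : productMeasure p₁ U₁ * productMeasure p₂ U₂ = s * t) : ∃ l, U₁ = star l := by
  have hs0 : 0 < s := ht.trans_le hts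
  have hst : 0 < s * t := mul_pos hs0 ht
  have hb0 : productMeasure p₂ U₂ ≠ 0 := fun h => by
    rw [h, mul_zero] at heq
    exact hst.ne heq
  have ha0 : productMeasure p₁ U₁ ≠ 0 := fun h => by
    rw [h, zero_mul] at heq
    exact hst.ne heq
  have hb : 0 < productMeasure p₂ U₂ :=
    (productMeasure_nonneg hp₂.mem_Icc U₂).lt_of_ne' hb0
  have hne₁ : U₁.Nonempty := nonempty_iff_ne_empty.2 fun h => ha0 (by simp [h, productMeasure])
  have hne₂ : U₂.Nonempty := nonempty_iff_ne_empty.2 fun h => hb0 (by simp [h, productMeasure])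
  have hemp₁ : ∅ ∉ U₁ := fun h => by
    obtain ⟨y, hy⟩ := hne₂
    simpa using hU _ h _ hy
  have hemp₂ : ∅ ∉ U₂ := fun h => by
    obtain ⟨y, hy⟩ := hne₁
    simpa using hU _ hy _ h
  have hform := sum_fourierForm hp₁ hp₂ s t hU
  have hE := sum_couplingWeight_nonneg hp₁ (fun l => (hs' l).trans hs) U₁
  have hQ : ∀ S ∈ univ.erase (∅ : Finset (Fin n)), 0 ≤ fourierForm p₁ p₂ s t U₁ U₂ S :=
    fun S hS => fourierForm_nonneg hp₁ hp₂ hts hs hs' ht' U₁ U₂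
      (nonempty_iff_ne_empty.2 (ne_of_mem_erase hS))
  have hQs := sum_nonneg hQ
  have hd : 0 ≤ s - t := sub_nonneg.2 hts
  rw [heq, sub_self, mul_zero] at hform
  have hT1 : 0 ≤ productMeasure p₂ U₂ ^ 2 * t * (productMeasure p₁ U₁ - s) ^ 2 := by positivity
  have hT2 : 0 ≤ productMeasure p₂ U₂ ^ 2 * (s - t) *
      ∑ S, couplingWeight p₁ p₁ S * coeff p₁ U₁ S ^ 2 := by positivity
  have ha : productMeasure p₁ U₁ = s := by
    have : productMeasure p₂ U₂ ^ 2 * t * (productMeasure p₁ U₁ - s) ^ 2 = 0 := by linarith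
    have h' : productMeasure p₂ U₂ ^ 2 * t ≠ 0 := by positivity
    exact sub_eq_zero.1 (pow_eq_zero_iff two_ne_zero |>.1 ((mul_eq_zero.1 this).resolve_left h'))
  have hbt : productMeasure p₂ U₂ = t := by
    rw [ha] at heq
    exact mul_left_cancel₀ hs0.ne' heq
  have hS0 : ∀ S : Finset (Fin n), S.Nonempty → fourierForm p₁ p₂ s t U₁ U₂ S = 0 := fun S hS =>
    (sum_eq_zero_iff_of_nonneg hQ).1 (by linarith) S
      (mem_erase.2 ⟨hS.ne_empty, mem_univ _⟩)
  have hzero : ∀ S : Finset (Fin n), S.Nonempty → _ → coeff p₁ U₁ S = 0 := fun S hS =>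
    coeff_eq_zero_of_fourierForm_eq_zero hp₁ hp₂ hts hs hs' ht' hb hS (hS0 S hS)
  refine exists_eq_star hp₁ hne₁ hemp₁ fun S hS2 => ?_
  have hS : S.Nonempty := card_pos.1 (by omega)
  by_contra hF
  -- A surviving coefficient of degree at least 2 needs a degenerate form, which the following steps
  -- reduce to |S| = 2 and s = 1/2.
  have hdeg := not_not.1 (mt (hzero S hS) hF)
  obtain ⟨hSw, hcard⟩ := hdeg
  have hsub : S ⊆ univ.filter fun l => p₁ l = s ∧ p₂ l = t := fun l hl =>
    mem_filter.2 ⟨mem_univ l, hSw l hl⟩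
  have hs2 : s = 1 / 2 := by
    rcases hcard with h | h | h
    · omega
    · exact h.2
    · exact h.1
  have hle2 : #S ≤ 2 := by
    rcases hcard with h | h | h
    · omega
    · exact h.1.le
    · have := card_le_card hsub
      by_contra! h3
      exact hw ⟨h.1, h.2, by omega⟩
  have hS2' : #S = 2 := le_antisymm hle2 hS2
  rcases hts.lt_or_eq with hlt | hts
  · have hE0 : ∑ S, couplingWeight p₁ p₁ S * coeff p₁ U₁ S ^ 2 = 0 := by
      have h : productMeasure p₂ U₂ ^ 2 * (s - t) *
          ∑ S, couplingWeight p₁ p₁ S * coeff p₁ U₁ S ^ 2 = 0 := by linarith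
      have h' : productMeasure p₂ U₂ ^ 2 * (s - t) ≠ 0 :=
        mul_ne_zero (pow_ne_zero 2 hb0) (sub_pos.2 hlt).ne'
      exact (mul_eq_zero.1 h).resolve_left h'
    exact hF (coeff_eq_zero_of_coupling_eq_zero hp₁ (fun l => (hs' l).trans hs) (ha.trans hs2)
      hE0 hS2')
  · obtain rfl : t = 1 / 2 := hts.trans hs2
    subst hs2
    have hcardw : #(univ.filter fun l => p₁ l = 1 / 2 ∧ p₂ l = 1 / 2) ≤ 2 := by
      by_contra! h
      exact hw ⟨rfl, rfl, h⟩
    -- Now S is the whole set of coordinates where both probabilities are 1/2, so every other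
    -- nonempty T with nonzero first coefficient is a singleton inside S.
    have hSeq := eq_of_subset_of_card_le hsub (hcardw.trans_eq hS2'.symm)
    have hrel : ∀ T : Finset (Fin n), T.Nonempty → (∀ l ∈ T, p₁ l = 1 / 2 ∧ p₂ l = 1 / 2) →
        coeff p₁ U₁ T + (-1) ^ #T * coeff p₂ U₂ T = 0 := fun T hT hTw => by
      have h := hS0 T hT
      rw [fourierForm_half hp₁ hbt hTw] at h
      have hW := parsevalWeight_pos hp₁ T
      exact pow_eq_zero_iff two_ne_zero |>.1 ((mul_eq_zero.1 h).resolve_left (by positivity))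
    have hχ : ∀ T : Finset (Fin n), (∀ l ∈ T, p₁ l = 1 / 2 ∧ p₂ l = 1 / 2) →
        parsevalWeight p₂ T = parsevalWeight p₁ T ∧ character p₂ T ∅ = character p₁ T ∅ :=
      fun T hT => ⟨prod_congr rfl fun l hl => by rw [(hT l hl).1, (hT l hl).2],
        prod_congr rfl fun l hl => by rw [(hT l hl).1, (hT l hl).2]⟩
    have e₁ := sum_parsevalWeight_mul_coeff_mul_character hp₁ U₁ ∅
    have e₂ := sum_parsevalWeight_mul_coeff_mul_character hp₂ U₂ ∅
    rw [if_neg hemp₁] at e₁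
    rw [if_neg hemp₂] at e₂
    -- Both indicators vanish at ∅, so their Fourier series there can be subtracted. All terms with
    -- T ≠ S cancel, whereas at S the two coefficients are opposite and the term doubles, forcing it
    -- to be 0.
    have e₃ : ∑ T, (parsevalWeight p₁ T * (coeff p₁ U₁ T * character p₁ T ∅) -
        parsevalWeight p₂ T * (coeff p₂ U₂ T * character p₂ T ∅)) = 0 := by
      rw [sum_sub_distrib, e₁, e₂, sub_zero]
    rw [sum_eq_single S] at e₃
    · have h := hrel S hS hSw
      rw [hS2', neg_one_sq, one_mul] at h
      rw [(hχ S hSw).1, (hχ S hSw).2, eq_neg_of_add_eq_zero_right h] at e₃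
      have hW := parsevalWeight_pos hp₁ S
      have hC : character p₁ S ∅ ≠ 0 := prod_ne_zero_iff.2 fun l hl => by
        rw [(hSw l hl).1]
        norm_num
      have : 2 * parsevalWeight p₁ S * character p₁ S ∅ * coeff p₁ U₁ S = 0 := by linarith
      exact hF ((mul_eq_zero.1 this).resolve_left (by positivity))
    · intro T _ hTS
      rcases T.eq_empty_or_nonempty with rfl | hT
      · rw [(hχ ∅ (by simp)).1, (hχ ∅ (by simp)).2, coeff_empty, coeff_empty, ha, hbt, sub_self]
      by_cases hTF : coeff p₁ U₁ T = 0
      · have h := hS0 T hT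
        have hW := parsevalWeight_pos hp₂ T
        rw [fourierForm, hTF] at h
        have h' : 1 / 2 ^ 3 * parsevalWeight p₂ T * coeff p₂ U₂ T ^ 2 = 0 := by linarith
        rw [hTF, pow_eq_zero_iff two_ne_zero |>.1
          ((mul_eq_zero.1 h').resolve_left (by positivity))]
        ring
      · obtain ⟨hTw, -⟩ := not_not.1 (mt (hzero T hT) hTF)
        have hTsub : T ⊆ S := fun l hl => by
          rw [hSeq]
          exact mem_filter.2 ⟨mem_univ l, hTw l hl⟩
        have hT1 : #T = 1 := by
          have h1 := hT.card_pos
          have h2 := card_lt_card (hTsub.ssubset_of_ne hTS)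
          omega
        have h := hrel T hT hTw
        rw [hT1] at h
        rw [(hχ T hTw).1, (hχ T hTw).2, show coeff p₁ U₁ T = coeff p₂ U₂ T by linarith, sub_self]
    · exact fun h => absurd (mem_univ S) h

theorem AreCrossIntersecting.symm {U₁ U₂ : Finset (Finset (Fin n))}
    (hU : AreCrossIntersecting U₁ U₂) : AreCrossIntersecting U₂ U₁ := fun y hy x hx => by
  rw [inter_comm]
  exact hU x hx y hy

/-! ### The ratio bound. -/

/-- The Hoffman-type ratio bound for cross-intersecting families. -/
theorem productMeasure_mul_le_ratio {p₁ p₂ : Fin n → ℝ} (hp₁ : IsProbabilityVector p₁)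
    (hp₂ : IsProbabilityVector p₂) (h₁ : ∀ l, p₁ l ≤ 1 / 2) (h₂ : ∀ l, p₂ l ≤ 1 / 2) {t : ℝ}
    (ht0 : 0 < t) (ht1 : t < 1) (ht : ∀ l, p₂ l ≤ t) {U₁ U₂ : Finset (Finset (Fin n))}
    (hU : AreCrossIntersecting U₁ U₂) :
    productMeasure p₁ U₁ * productMeasure p₂ U₂ ≤
      t / (1 - t) * ((1 - productMeasure p₁ U₁) * (1 - productMeasure p₂ U₂)) := by
  have e₁ := sum_parsevalWeight_mul_coeff_sq hp₁ U₁
  have e₂ := sum_parsevalWeight_mul_coeff_sq hp₂ U₂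
  have e₃ := sum_couplingWeight_eq_zero hp₁ hp₂ hU
  have ha0 := productMeasure_nonneg hp₁.mem_Icc U₁
  have hb0 := productMeasure_nonneg hp₂.mem_Icc U₂
  have ha1 := productMeasure_le_one hp₁.mem_Icc U₁
  have hb1 := productMeasure_le_one hp₂.mem_Icc U₂
  rw [← add_sum_erase univ _ (mem_univ ∅), coeff_empty] at e₁ e₂ e₃
  rw [coeff_empty] at e₃
  simp only [parsevalWeight, couplingWeight, prod_empty, one_mul] at e₁ e₂ e₃
  set a := productMeasure p₁ U₁
  set b := productMeasure p₂ U₂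
  have hR : 0 < t / (1 - t) := div_pos ht0 (by linarith)
  set R := t / (1 - t) with hRdef
  have hV : ∀ S : Finset (Fin n), S.Nonempty → couplingWeight p₁ p₂ S ^ 2 ≤
      R * (parsevalWeight p₁ S * parsevalWeight p₂ S) := fun S hS => by
    have hW := mul_pos (parsevalWeight_pos hp₁ S) (parsevalWeight_pos hp₂ S)
    rw [couplingWeight_sq hp₁ hp₂]
    refine mul_le_mul_of_nonneg_right ?_ hW.le
    have hX : oddsProd p₁ S ≤ 1 := by
      simpa using oddsProd_le_pow hp₁ le_rfl h₁ (Nat.zero_le (#S))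
    -- `t` may exceed 1/2, where powers of its odds no longer decrease; the minimum with 1/2 is
    -- still an upper bound for `p₂`.
    have hY := oddsProd_le_pow hp₂ (min_le_right t (1 / 2)) (fun l => le_min (ht l) (h₂ l))
      hS.card_pos
    rw [Nat.succ_eq_add_one, zero_add, pow_one] at hY
    have hY' := hY.trans (odds_le_odds ht1 (min_le_left t (1 / 2)))
    calc oddsProd p₁ S * oddsProd p₂ S ≤ 1 * R :=
          mul_le_mul hX hY' (oddsProd_pos hp₂ S).le zero_le_one
      _ = R := one_mul R
  -- Removing the terms at ∅ from Parseval and from the coupling relation leaves this quadratic in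
  -- the free scaling x; its discriminant gives the bound after cancelling ab.
  have hquad : ∀ x : ℝ, 0 ≤ a * (1 - a) * (x * x) + -2 * (a * b) * x + R * (b * (1 - b)) := by
    intro x
    have h : 0 ≤ ∑ S ∈ univ.erase ∅,
        (x ^ 2 * parsevalWeight p₁ S * coeff p₁ U₁ S ^ 2 +
          R * parsevalWeight p₂ S * coeff p₂ U₂ S ^ 2 +
          2 * (x * couplingWeight p₁ p₂ S) * (coeff p₁ U₁ S * coeff p₂ U₂ S)) := by
      refine sum_nonneg fun S hS => binary_form_nonneg
        (mul_pos hR (parsevalWeight_pos hp₂ S)) ?_ _ _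
      rw [mul_pow]
      have := mul_le_mul_of_nonneg_left
        (hV S (nonempty_iff_ne_empty.2 (ne_of_mem_erase hS))) (sq_nonneg x)
      linarith
    simp only [sum_add_distrib, mul_assoc, ← mul_sum] at h
    simp only [parsevalWeight, couplingWeight] at h
    linear_combination h + x ^ 2 * e₁ + R * e₂ + 2 * x * e₃
  have hdisc := discrim_le_zero hquad
  rw [discrim] at hdisc
  rcases (mul_nonneg ha0 hb0).eq_or_lt with h0 | h0
  · rw [← h0]
    exact mul_nonneg hR.le (mul_nonneg (sub_nonneg.2 ha1) (sub_nonneg.2 hb1))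
  · refine le_of_mul_le_mul_left ?_ h0
    linarith

/-! ### Dependence on a single coordinate. -/

theorem weight_update (p : Fin n → ℝ) (i : Fin n) (t : ℝ) (x : Finset (Fin n)) :
    weight (Function.update p i t) x = (if i ∈ x then t else 1 - t) *
      ∏ l ∈ univ.erase i, if l ∈ x then p l else 1 - p l := by
  rw [weight_eq_prod, ← mul_prod_erase univ _ (mem_univ i)]
  congr 1
  · simp
  · exact prod_congr rfl fun l hl => by rw [Function.update_of_ne (ne_of_mem_erase hl)]

theorem productMeasure_eq_sum_ite (p : Fin n → ℝ) (U : Finset (Finset (Fin n))) :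
    productMeasure p U = ∑ x, weight p x * if x ∈ U then 1 else 0 := by
  simp [productMeasure_eq_sum_weight]

theorem productMeasure_update (p : Fin n → ℝ) (i : Fin n) (t : ℝ)
    (U : Finset (Finset (Fin n))) :
    productMeasure (Function.update p i t) U =
      ∑ x ∈ (univ.erase i).powerset, (∏ l ∈ univ.erase i, if l ∈ x then p l else 1 - p l) *
        ((1 - t) * (if x ∈ U then 1 else 0) + t * if insert i x ∈ U then 1 else 0) := by
  rw [productMeasure_eq_sum_ite, ← powerset_univ, ← insert_erase (mem_univ i),
    sum_powerset_insert (notMem_erase i univ), ← sum_add_distrib, insert_erase (mem_univ i)]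
  refine sum_congr rfl fun x hx => ?_
  have hix : i ∉ x := fun h => notMem_erase i univ (mem_powerset.1 hx h)
  have e : ∏ l ∈ univ.erase i, (if l ∈ insert i x then p l else 1 - p l) =
      ∏ l ∈ univ.erase i, if l ∈ x then p l else 1 - p l :=
    prod_congr rfl fun l hl => by simp [ne_of_mem_erase hl]
  rw [weight_update, weight_update, e, if_neg hix, if_pos (mem_insert_self i x)]
  ring

theorem productMeasure_update_affine (p : Fin n → ℝ) (i : Fin n) (t : ℝ)
    (U : Finset (Finset (Fin n))) :
    productMeasure (Function.update p i t) U =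
      (1 - t) * productMeasure (Function.update p i 0) U +
        t * productMeasure (Function.update p i 1) U := by
  simp only [productMeasure_update, mul_sum, ← sum_add_distrib]
  exact sum_congr rfl fun x _ => by ring

theorem productMeasure_affine (p : Fin n → ℝ) (i : Fin n) (U : Finset (Finset (Fin n))) :
    productMeasure p U = (1 - p i) * productMeasure (Function.update p i 0) U +
      p i * productMeasure (Function.update p i 1) U := by
  rw [← productMeasure_update_affine, Function.update_eq_self]

theorem productMeasure_update_filter_insert (p : Fin n → ℝ) (i : Fin n) (t : ℝ)
    (U : Finset (Finset (Fin n))) :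
    productMeasure (Function.update p i t) (univ.filter fun x => insert i x ∈ U) =
      productMeasure (Function.update p i 1) U := by
  simp only [productMeasure_update, mem_filter, mem_univ, true_and, insert_idem]
  exact sum_congr rfl fun x _ => by ring

theorem productMeasure_update_filter_erase (p : Fin n → ℝ) (i : Fin n) (t : ℝ)
    (U : Finset (Finset (Fin n))) :
    productMeasure (Function.update p i t) (univ.filter fun x => x.erase i ∈ U) =
      productMeasure (Function.update p i 0) U := by
  simp only [productMeasure_update, mem_filter, mem_univ, true_and]
  refine sum_congr rfl fun x hx => ?_
  have hix : i ∉ x := fun h => notMem_erase i univ (mem_powerset.1 hx h)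
  rw [erase_eq_of_notMem hix, erase_insert hix]
  ring

theorem productMeasure_star (p : Fin n → ℝ) (i : Fin n) : productMeasure p (star i) = p i := by
  have h1 := productMeasure_update p i (p i) (star i)
  have h2 := productMeasure_update p i (p i) univ
  rw [Function.update_eq_self] at h1 h2
  rw [productMeasure_univ] at h2
  have h3 := congrArg (p i * ·) h2
  simp only [mul_one, mul_sum] at h3
  refine h1.trans (Eq.trans ?_ h3.symm)
  refine sum_congr rfl fun x hx => ?_
  have hix : i ∉ x := fun h => notMem_erase i univ (mem_powerset.1 hx h)
  simp [star, hix, mul_comm]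

theorem IsProbabilityVector.update {p : Fin n → ℝ} (hp : IsProbabilityVector p) (i : Fin n)
    {t : ℝ} (h0 : 0 < t) (h1 : t < 1) : IsProbabilityVector (Function.update p i t) := by
  intro l
  rcases eq_or_ne l i with rfl | hl
  · simp [h0, h1]
  · simpa [hl] using hp l

theorem update_le {p : Fin n → ℝ} {i : Fin n} {s t : ℝ} (ht : t ≤ s)
    (hp : ∀ l, l ≠ i → p l ≤ s) (l : Fin n) : Function.update p i t l ≤ s := by
  rcases eq_or_ne l i with rfl | hl
  · simpa using ht
  · simpa [hl] using hp l hl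

theorem eq_univ_of_productMeasure_eq_one {p : Fin n → ℝ} (hp : IsProbabilityVector p)
    {U : Finset (Finset (Fin n))} (h : productMeasure p U = 1) : U = univ :=
  eq_of_subset_of_productMeasure_le hp (subset_univ U) (by rw [h, productMeasure_univ])

/-! ### Probabilities above 1/2. -/

/-- The bound when the first measure is concentrated on the sets containing `i`. -/
theorem productMeasure_update_one_mul_le {p₁ p₂ : Fin n → ℝ} (hp₁ : IsProbabilityVector p₁)
    (hp₂ : IsProbabilityVector p₂) {i : Fin n} (h₁ : ∀ l, l ≠ i → p₁ l ≤ 1 / 2)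
    (h₂ : ∀ l, l ≠ i → p₂ l ≤ 1 / 2) (hmax : ∀ l, p₂ l ≤ p₂ i)
    {U₁ U₂ : Finset (Finset (Fin n))} (hU : AreCrossIntersecting U₁ U₂) :
    productMeasure (Function.update p₁ i 1) U₁ * productMeasure p₂ U₂ ≤ p₂ i ∧
      (productMeasure (Function.update p₁ i 1) U₁ * productMeasure p₂ U₂ = p₂ i →
        U₁ = star i) := by
  have ht0 := (hp₂ i).1
  have ht1 := (hp₂ i).2
  -- The families used below do not depend on coordinate `i`, so its probability can be reset to
  -- values at most 1/2, as the ratio bound requires.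
  have hq₁ := hp₁.update i (t := 1 / 2) (by norm_num) (by norm_num)
  have hm0 : 0 < min (p₂ i) (1 / 2) := lt_min ht0 (by norm_num)
  have hq₂ := hp₂.update i hm0 ((min_le_left _ _).trans_lt ht1)
  have hcross : AreCrossIntersecting (univ.filter fun x => insert i x ∈ U₁)
      (univ.filter fun x => x.erase i ∈ U₂) := by
    intro x hx y hy
    simp only [mem_filter, mem_univ, true_and] at hx hy
    obtain ⟨l, hl⟩ := hU _ hx _ hy
    simp only [mem_inter, mem_insert, mem_erase] at hl
    exact ⟨l, mem_inter.2 ⟨hl.1.resolve_left hl.2.1, hl.2.2⟩⟩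
  have hratio := productMeasure_mul_le_ratio hq₁ hq₂ (update_le le_rfl h₁)
    (update_le (min_le_right _ _) h₂) ht0 ht1
    (update_le (min_le_left _ _) fun l _ => hmax l) hcross
  have hA0 := productMeasure_nonneg hq₁.mem_Icc (univ.filter fun x => insert i x ∈ U₁)
  have hA1 := productMeasure_le_one hq₁.mem_Icc (univ.filter fun x => insert i x ∈ U₁)
  have hB0 := productMeasure_nonneg hq₂.mem_Icc (univ.filter fun x => x.erase i ∈ U₂)
  have hC1 := productMeasure_le_one hq₂.mem_Icc (univ.filter fun x => insert i x ∈ U₂)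
  have hC := productMeasure_update_filter_insert p₂ i (min (p₂ i) (1 / 2)) U₂
  have hA := productMeasure_update_filter_insert p₁ i (1 / 2) U₁
  rw [hA] at hratio hA0 hA1
  rw [productMeasure_update_filter_erase] at hratio hB0
  rw [hC] at hC1
  rw [productMeasure_affine p₂ i U₂]
  set a := productMeasure (Function.update p₁ i 1) U₁
  set b := productMeasure (Function.update p₂ i 0) U₂
  set c := productMeasure (Function.update p₂ i 1) U₂
  set t := p₂ i
  have hratio' : (1 - t) * (a * b) ≤ t * ((1 - a) * (1 - b)) := by
    have := mul_le_mul_of_nonneg_left hratio (sub_pos.2 ht1).le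
    rwa [← mul_assoc (1 - t) (t / (1 - t)), mul_div_cancel₀ _ (sub_pos.2 ht1).ne'] at this
  have k1 : 0 ≤ t * (b * (1 - a)) := by
    have := sub_nonneg.2 hA1
    positivity
  have k2 : 0 ≤ t * (a * (1 - c)) := by
    have := sub_nonneg.2 hC1
    positivity
  -- By the ratio bound, t - a((1 - t) b + t c) is at least t b (1 - a) + t a (1 - c).
  refine ⟨by linarith, fun h => ?_⟩
  have k3 : t * (b * (1 - a)) = 0 := by linarith
  have k4 : t * (a * (1 - c)) = 0 := by linarith
  have ha : a ≠ 0 := fun h0 => by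
    rw [h0, zero_mul] at h
    exact ht0.ne h
  have hc : c = 1 := by
    have := (mul_eq_zero.1 ((mul_eq_zero.1 k4).resolve_left ht0.ne')).resolve_left ha
    linarith
  have ha1 : a = 1 := by
    rcases mul_eq_zero.1 ((mul_eq_zero.1 k3).resolve_left ht0.ne') with hb | hb
    · rw [hb, hc] at h
      exact mul_right_cancel₀ ht0.ne' (by linarith : a * t = 1 * t)
    · linarith
  have u₁ := eq_univ_of_productMeasure_eq_one hq₁ (hA.trans ha1)
  have u₂ := eq_univ_of_productMeasure_eq_one hq₂ (hC.trans hc)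
  have hmem₁ : ∀ x, insert i x ∈ U₁ := fun x => filter_eq_self.1 u₁ x (mem_univ x)
  have hmem₂ : ∀ x, insert i x ∈ U₂ := fun x => filter_eq_self.1 u₂ x (mem_univ x)
  ext x
  simp only [star, mem_filter, mem_univ, true_and]
  constructor
  · intro hx
    obtain ⟨l, hl⟩ := hU x hx _ (hmem₂ ∅)
    simp only [mem_inter, mem_insert, notMem_empty, or_false] at hl
    exact hl.2 ▸ hl.1
  · intro hx
    simpa [insert_eq_of_mem hx] using hmem₁ x

/-- By affinity, the measure at p is 2(1 - p) times the one at 1/2 plus (2p - 1) times the one at 1.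
The last weight is positive, so equality passes to the endpoint 1. -/
theorem productMeasure_mul_le_of_half_lt {p₁ p₂ : Fin n → ℝ} (hp₁ : IsProbabilityVector p₁)
    (hp₂ : IsProbabilityVector p₂) {i : Fin n} (h₁ : ∀ l, l ≠ i → p₁ l ≤ 1 / 2)
    (h₂ : ∀ l, l ≠ i → p₂ l ≤ 1 / 2) (hmax : ∀ l, p₂ l ≤ p₂ i)
    {U₁ U₂ : Finset (Finset (Fin n))} (hU : AreCrossIntersecting U₁ U₂) (hi : 1 / 2 < p₁ i)
    (hhalf : productMeasure (Function.update p₁ i (1 / 2)) U₁ * productMeasure p₂ U₂ ≤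
      1 / 2 * p₂ i) :
    productMeasure p₁ U₁ * productMeasure p₂ U₂ ≤ p₁ i * p₂ i ∧
      (productMeasure p₁ U₁ * productMeasure p₂ U₂ = p₁ i * p₂ i → U₁ = star i) := by
  obtain ⟨hle, heq⟩ := productMeasure_update_one_mul_le hp₁ hp₂ h₁ h₂ hmax hU
  rw [productMeasure_update_affine] at hhalf
  rw [productMeasure_affine p₁ i U₁]
  have k1 := mul_le_mul_of_nonneg_left hhalf (sub_pos.2 (hp₁ i).2).le
  have k2 : 0 < p₁ i - 1 / 2 := sub_pos.2 hi
  have k3 := mul_le_mul_of_nonneg_left hle k2.le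
  refine ⟨by linarith, fun h => heq (mul_left_cancel₀ k2.ne' ?_)⟩
  exact le_antisymm k3 (by linarith)

theorem productMeasure_mul_le_of_right_le_half {p₁ p₂ : Fin n → ℝ}
    (hp₁ : IsProbabilityVector p₁) (hp₂ : IsProbabilityVector p₂) {i : Fin n}
    (h₁ : ∀ l, l ≠ i → p₁ l ≤ 1 / 2) (hmax₁ : ∀ l, p₁ l ≤ p₁ i) (hmax₂ : ∀ l, p₂ l ≤ p₂ i)
    (hi : p₂ i ≤ 1 / 2) {U₁ U₂ : Finset (Finset (Fin n))} (hU : AreCrossIntersecting U₁ U₂) :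
    productMeasure p₁ U₁ * productMeasure p₂ U₂ ≤ p₁ i * p₂ i := by
  rcases le_or_gt (p₁ i) (1 / 2) with hi₁ | hi₁
  · rcases le_total (p₂ i) (p₁ i) with h | h
    · exact productMeasure_mul_le_of_le_half hp₁ hp₂ (hp₂ i).1 h hi₁ hmax₁ hmax₂ hU
    · rw [mul_comm, mul_comm (p₁ i)]
      exact productMeasure_mul_le_of_le_half hp₂ hp₁ (hp₁ i).1 h hi hmax₂ hmax₁ hU.symm
  · refine (productMeasure_mul_le_of_half_lt hp₁ hp₂ h₁ (fun l _ => (hmax₂ l).trans hi)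
      hmax₂ hU hi₁ ?_).1
    exact productMeasure_mul_le_of_le_half (hp₁.update i (by norm_num) (by norm_num)) hp₂
      (hp₂ i).1 hi le_rfl (update_le le_rfl h₁) hmax₂ hU

theorem productMeasure_mul_le {p₁ p₂ : Fin n → ℝ}
    (hp₁ : IsProbabilityVector p₁) (hp₂ : IsProbabilityVector p₂) {i : Fin n}
    (h₁ : ∀ l, l ≠ i → p₁ l ≤ 1 / 2) (h₂ : ∀ l, l ≠ i → p₂ l ≤ 1 / 2)
    (hmax₁ : ∀ l, p₁ l ≤ p₁ i) (hmax₂ : ∀ l, p₂ l ≤ p₂ i)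
    {U₁ U₂ : Finset (Finset (Fin n))} (hU : AreCrossIntersecting U₁ U₂) :
    productMeasure p₁ U₁ * productMeasure p₂ U₂ ≤ p₁ i * p₂ i := by
  rcases le_or_gt (p₂ i) (1 / 2) with hi | hi
  · exact productMeasure_mul_le_of_right_le_half hp₁ hp₂ h₁ hmax₁ hmax₂ hi hU
  · rw [mul_comm, mul_comm (p₁ i)]
    refine (productMeasure_mul_le_of_half_lt hp₂ hp₁ h₂ h₁ hmax₁ hU.symm hi ?_).1
    have h := productMeasure_mul_le_of_right_le_half hp₁
      (hp₂.update i (t := 1 / 2) (by norm_num) (by norm_num)) h₁ hmax₁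
      (fun l => by simpa using update_le le_rfl h₂ l) (by simp) hU
    rw [Function.update_self] at h
    linarith

/-! ### The extremal families. -/

theorem exists_eq_star_of_productMeasure_mul_eq {p₁ p₂ : Fin n → ℝ}
    (hp₁ : IsProbabilityVector p₁) (hp₂ : IsProbabilityVector p₂) {i : Fin n}
    (h₁ : ∀ l, l ≠ i → p₁ l ≤ 1 / 2) (h₂ : ∀ l, l ≠ i → p₂ l ≤ 1 / 2)
    (hmax₁ : ∀ l, p₁ l ≤ p₁ i) (hmax₂ : ∀ l, p₂ l ≤ p₂ i)
    {U₁ U₂ : Finset (Finset (Fin n))} (hU : AreCrossIntersecting U₁ U₂)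
    (hw : ¬ (p₁ i = 1 / 2 ∧ p₂ i = 1 / 2 ∧ 3 ≤ #(sameCoordinates p₁ p₂ i)))
    (heq : productMeasure p₁ U₁ * productMeasure p₂ U₂ = p₁ i * p₂ i) :
    ∃ l, U₁ = star l ∨ U₂ = star l := by
  simp only [sameCoordinates, Prod.mk.injEq] at hw
  have heq' : productMeasure p₂ U₂ * productMeasure p₁ U₁ = p₂ i * p₁ i := by
    rw [mul_comm, heq, mul_comm]
  rcases le_or_gt (p₁ i) (1 / 2) with hi₁ | hi₁
  · rcases le_or_gt (p₂ i) (1 / 2) with hi₂ | hi₂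
    · rcases le_total (p₂ i) (p₁ i) with h | h
      · obtain ⟨l, hl⟩ := exists_eq_star_of_le_half hp₁ hp₂ (hp₂ i).1 h hi₁ hmax₁ hmax₂ hU hw heq
        exact ⟨l, Or.inl hl⟩
      · obtain ⟨l, hl⟩ := exists_eq_star_of_le_half hp₂ hp₁ (hp₁ i).1 h hi₂ hmax₂ hmax₁ hU.symm
          (fun hc => hw ⟨hc.2.1, hc.1, by simpa only [and_comm] using hc.2.2⟩) heq'
        exact ⟨l, Or.inr hl⟩
    · refine ⟨i, Or.inr ?_⟩
      refine (productMeasure_mul_le_of_half_lt hp₂ hp₁ h₂ h₁ hmax₁ hU.symm hi₂ ?_).2 heq'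
      have h := productMeasure_mul_le (hp₂.update i (t := 1 / 2) (by norm_num) (by norm_num)) hp₁
        (fun l _ => update_le le_rfl h₂ l) h₁
        (fun l => by simpa using update_le le_rfl h₂ l) hmax₁ hU.symm
      rwa [Function.update_self] at h
  · refine ⟨i, Or.inl ?_⟩
    refine (productMeasure_mul_le_of_half_lt hp₁ hp₂ h₁ h₂ hmax₂ hU hi₁ ?_).2 heq
    have h := productMeasure_mul_le (hp₁.update i (t := 1 / 2) (by norm_num) (by norm_num)) hp₂
      (fun l _ => update_le le_rfl h₁ l) h₂
      (fun l => by simpa using update_le le_rfl h₁ l) hmax₂ hU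
    rwa [Function.update_self] at h

/-- Since {l} belongs to the star, the other family lies inside the star; equality of the products
then leaves no slack in the inclusion or in either maximum. -/
theorem eq_star_of_eq_star {p₁ p₂ : Fin n → ℝ}
    (hp₁ : IsProbabilityVector p₁) (hp₂ : IsProbabilityVector p₂) {i l : Fin n}
    (hmax₁ : ∀ l, p₁ l ≤ p₁ i) (hmax₂ : ∀ l, p₂ l ≤ p₂ i) {U : Finset (Finset (Fin n))}
    (hU : AreCrossIntersecting (star l) U)
    (heq : productMeasure p₁ (star l) * productMeasure p₂ U = p₁ i * p₂ i) :
    (p₁ l = p₁ i ∧ p₂ l = p₂ i) ∧ U = star l := by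
  have hsub : U ⊆ star l := fun y hy => by
    obtain ⟨m, hm⟩ := hU {l} (by simp [star]) y hy
    simp only [mem_inter, mem_singleton] at hm
    simpa [star, hm.1] using hm.2
  have hle := productMeasure_mono hp₂.mem_Icc hsub
  rw [productMeasure_star] at hle heq
  have hl := (hp₁ l).1
  have k1 : 0 ≤ p₁ l * (p₂ i - productMeasure p₂ U) :=
    mul_nonneg hl.le (sub_nonneg.2 (hle.trans (hmax₂ l)))
  have k2 : 0 ≤ (p₁ i - p₁ l) * p₂ i := mul_nonneg (sub_nonneg.2 (hmax₁ l)) (hp₂ i).1.le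
  have k3 : p₁ l * (p₂ i - productMeasure p₂ U) = 0 := by linarith
  have k4 : (p₁ i - p₁ l) * p₂ i = 0 := by linarith
  have k5 := (mul_eq_zero.1 k3).resolve_left hl.ne'
  have k6 := (mul_eq_zero.1 k4).resolve_right (hp₂ i).1.ne'
  have k7 := hmax₂ l
  exact ⟨⟨by linarith, by linarith⟩, eq_of_subset_of_productMeasure_le hp₂ hsub (by
    rw [productMeasure_star]
    linarith)⟩

end CrossIntersecting

theorem mainTheorem1 (n : ℕ) (hn : 0 < n) (p₁ p₂ : Fin n → ℝ)
    (hp₁ : CrossIntersecting.IsProbabilityVector p₁)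
    (hp₂ : CrossIntersecting.IsProbabilityVector p₂)
    (hmax₁ : IsGreatest (Set.range p₁) (p₁ ⟨0, hn⟩))
    (hmax₂ : IsGreatest (Set.range p₂) (p₂ ⟨0, hn⟩))
    (hhalf₁ : ∀ l : Fin n, l ≠ ⟨0, hn⟩ → p₁ l ≤ 1 / 2)
    (hhalf₂ : ∀ l : Fin n, l ≠ ⟨0, hn⟩ → p₂ l ≤ 1 / 2)
    (U₁ U₂ : Finset (Finset (Fin n)))
    (hU : CrossIntersecting.AreCrossIntersecting U₁ U₂) :
    CrossIntersecting.productMeasure p₁ U₁ * CrossIntersecting.productMeasure p₂ U₂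
        ≤ p₁ ⟨0, hn⟩ * p₂ ⟨0, hn⟩ ∧
      (¬ (p₁ ⟨0, hn⟩ = 1 / 2 ∧ p₂ ⟨0, hn⟩ = 1 / 2 ∧
          3 ≤ (CrossIntersecting.sameCoordinates p₁ p₂ ⟨0, hn⟩).card) →
        (CrossIntersecting.productMeasure p₁ U₁ * CrossIntersecting.productMeasure p₂ U₂
            = p₁ ⟨0, hn⟩ * p₂ ⟨0, hn⟩ ↔
          ∃ l ∈ CrossIntersecting.sameCoordinates p₁ p₂ ⟨0, hn⟩,
            U₁ = CrossIntersecting.star l ∧ U₂ = CrossIntersecting.star l)) := by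
  have hm₁ : ∀ l, p₁ l ≤ p₁ ⟨0, hn⟩ := fun l => hmax₁.2 ⟨l, rfl⟩
  have hm₂ : ∀ l, p₂ l ≤ p₂ ⟨0, hn⟩ := fun l => hmax₂.2 ⟨l, rfl⟩
  refine ⟨CrossIntersecting.productMeasure_mul_le hp₁ hp₂ hhalf₁ hhalf₂ hm₁ hm₂ hU,
    fun hw => ⟨fun heq => ?_, ?_⟩⟩
  · obtain ⟨l, rfl | rfl⟩ := CrossIntersecting.exists_eq_star_of_productMeasure_mul_eq
      hp₁ hp₂ hhalf₁ hhalf₂ hm₁ hm₂ hU hw heq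
    · obtain ⟨⟨h₁, h₂⟩, h⟩ := CrossIntersecting.eq_star_of_eq_star hp₁ hp₂ hm₁ hm₂ hU heq
      exact ⟨l, by simp [CrossIntersecting.sameCoordinates, h₁, h₂], rfl, h⟩
    · obtain ⟨⟨h₂, h₁⟩, h⟩ := CrossIntersecting.eq_star_of_eq_star hp₂ hp₁ hm₂ hm₁ hU.symm
        (by rw [mul_comm, heq, mul_comm])
      exact ⟨l, by simp [CrossIntersecting.sameCoordinates, h₁, h₂], h, rfl⟩
  · rintro ⟨l, hl, rfl, rfl⟩
    simp only [CrossIntersecting.sameCoordinates, Finset.mem_filter, Finset.mem_univ, true_and,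
      Prod.mk.injEq] at hl
    rw [CrossIntersecting.productMeasure_star, CrossIntersecting.productMeasure_star, hl.1, hl.2]
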